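/- Theorem (Converse bound). Let $\mathcal S\subset\mathbb Z^d$ be a finite lattice, partitioned into regions $\{\mathcal S_r\}_{r\in\mathcal R}$, and let $X=\{X(s)\}_{s\in\mathcal S}$ be a piecewise homogeneous Gaussian random field: $X$ is jointly Gaussian, and for each $r$ there are $m_r\in\mathbb R$ and an even positive semidefinite $\Gamma_r:\mathbb Z^d\to\mathbb R$ with $\mathbb E[X(s)]=m_r$ and $\operatorname{Cov}(X(s),X(t))=\Gamma_r(s-t)$ for $s,t\in\mathcal S_r$, while $\operatorname{Cov}(X(s),X(t))=0$ for $s,t$ in different regions. Write $X_r=X|_{\mathcal S_r}$ and $d(x,\hat x)=\frac1{|\mathcal S|}\sum_{s\in\mathcal S}(x(s)-\hat x(s))^2$ for $x,\hat x\in\mathbb R^{\mathcal S}$. Let $$R(D)=\inf_{P_{\hat X|X}:\ \mathbb E[d(X,\hat X)]\le D} I(X;\hat X)$$ be the rate--distortion function of $X$ (in nats, not divided by $|\mathcal S|$), the infimum being over all Markov kernels from $\mathbb R^{\mathcal S}$ to $\mathbb R^{\mathcal S}$. Let $D\ge 0$ be such that $R$ is finite and differentiable at $D$, put $\lambda^\star=-R'(D)$,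 let $P^\star_{\hat X|X}$ be a kernel achieving $R(D)$, with induced output marginal $P^\star_{\hat X}$, and let $$\jmath_X(x,D)=-\log \mathbb E_{\hat X\sim P^\star_{\hat X}}\bigl[\exp\bigl(\lambda^\star(D-d(x,\hat X))\bigr)\bigr]$$ be the distortion-tilted information density. Consider any regionwise code, that is, encoders $f_r:\mathbb R^{\mathcal S_r}\to\{1,\dots,M_r\}$ and decoders $\phi_r:\{1,\dots,M_r\}\to\mathbb R^{\mathcal S_r}$ for $r\in\mathcal R$, with reconstruction $\hat X$ given on each $\mathcal S_r$ by $\phi_r(f_r(X_r))$. Let $M=\prod_{r\in\mathcal R}M_r$ and $P_e(D)=\Pr\{d(X,\hat X)>D\}$. Then, for every $\gamma>0$, $$P_e(D)\ \ge\ \Pr\{\jmath_X(X,D)\ge \log M+\gamma\}-e^{-\gamma}.$$ -/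

import Mathlib

open MeasureTheory ProbabilityTheory
open scoped ENNReal

noncomputable section

/-! ### Lattice regions

A finite lattice is a finite set `S` of points of `ℤ^d`.  A partition of `S` into regions indexed
by `ι` is given by its region label map `label : S → ι`; the region with index `r` is the set of
sites with label `r`. -/

/-- The region `S_r` of the partition with label map `label`. -/
abbrev Region {d : ℕ} {S : Finset (Fin d → ℤ)} {ι : Type*} (label : S → ι) (r : ι) : Type :=
  {s : S // label s = r}

/-- The restriction `x_r` of a field realization `x` to the region `S_r`. -/
def restrictRegion {d : ℕ} {S : Finset (Fin d → ℤ)} {ι : Type*} (label : S → ι) (r : ι)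
    (x : S → ℝ) : Region label r → ℝ :=
  fun s => x s.1

/-! ### The source -/

/-- `G` is a (real, stationary) covariance function on `ℤ^d`: even and positive semidefinite. -/
def IsStationaryCovariance {d : ℕ} (G : (Fin d → ℤ) → ℝ) : Prop :=
  (∀ h, G (-h) = G h) ∧
  ∀ (F : Finset (Fin d → ℤ)) (a : (Fin d → ℤ) → ℝ),
    0 ≤ ∑ s ∈ F, ∑ t ∈ F, a s * a t * G (s - t)

/-- A piecewise homogeneous Gaussian random field on `S`: jointly Gaussian, with constant mean
`m r` and stationary covariance `Γ r` on each region `S_r`, and with vanishing covariance across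
different regions. -/
structure IsPiecewiseHomogeneousGaussian {Ω : Type*} [MeasurableSpace Ω] (P : Measure Ω)
    {d : ℕ} {S : Finset (Fin d → ℤ)} {ι : Type*} (label : S → ι)
    (m : ι → ℝ) (Γ : ι → (Fin d → ℤ) → ℝ) (X : Ω → S → ℝ) : Prop where
  measurable : Measurable X
  gaussian : HasGaussianLaw X P
  stationaryCov : ∀ r, IsStationaryCovariance (Γ r)
  mean_eq : ∀ s : S, ∫ ω, X ω s ∂P = m (label s)
  cov_eq : ∀ s t : S, label s = label t →
    covariance (fun ω => X ω s) (fun ω => X ω t) P = Γ (label s) (s.1 - t.1)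
  cov_cross : ∀ s t : S, label s ≠ label t →
    covariance (fun ω => X ω s) (fun ω => X ω t) P = 0

/-! ### Distortion and regionwise codes -/

/-- Normalized mean squared error `d(x, y) = |S|⁻¹ ∑ₛ (x(s) - y(s))²`. -/
def mseDistortion {d : ℕ} {S : Finset (Fin d → ℤ)} (x y : S → ℝ) : ℝ :=
  1 / (S.card : ℝ) * ∑ s : S, (x s - y s) ^ 2

/-- A regionwise code with `M r` codewords for region `S_r`: for each region an encoder
`ℝ^{S_r} → [M_r]` and a decoder `[M_r] → ℝ^{S_r}`. -/
structure RegionwiseCode {d : ℕ} {S : Finset (Fin d → ℤ)} {ι : Type*} (label : S → ι)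
    (M : ι → ℕ) where
  encode : ∀ r, (Region label r → ℝ) → Fin (M r)
  decode : ∀ r, Fin (M r) → (Region label r → ℝ)

/-- The global reconstruction, assembled from the regional reconstructions. -/
def RegionwiseCode.reconstruct {d : ℕ} {S : Finset (Fin d → ℤ)} {ι : Type*} {label : S → ι}
    {M : ι → ℕ} (c : RegionwiseCode label M) (x : S → ℝ) : S → ℝ :=
  fun s => c.decode (label s) (c.encode (label s) (restrictRegion label (label s) x)) ⟨s, rfl⟩

/-- The excess-distortion probability `Pr{d(X, X̂) > D}` of a regionwise code. -/
def RegionwiseCode.excessProb {Ω : Type*} [MeasurableSpace Ω] (P : Measure Ω)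
    {d : ℕ} {S : Finset (Fin d → ℤ)} {ι : Type*} {label : S → ι} {M : ι → ℕ}
    (c : RegionwiseCode label M) (X : Ω → S → ℝ) (D : ℝ) : ℝ :=
  P.real {ω | D < mseDistortion (X ω) (c.reconstruct (X ω))}

/-! ### The rate-distortion function -/

/-- Mutual information (in nats) between the input and the output of the kernel `κ` under the
input law `μ`: the relative entropy of the joint law with respect to the product of marginals. -/
def mutualInfo {α β : Type*} [MeasurableSpace α] [MeasurableSpace β] (μ : Measure α)
    (κ : Kernel α β) : ℝ≥0∞ :=
  InformationTheory.klDiv (μ ⊗ₘ κ) (μ.prod (κ ∘ₘ μ))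

/-- The reproduction kernel `κ` meets the average distortion constraint `E[d(X, X̂)] ≤ D`
(in particular the expectation is finite). -/
def MeetsDistortion {d : ℕ} {S : Finset (Fin d → ℤ)} (μ : Measure (S → ℝ))
    (κ : Kernel (S → ℝ) (S → ℝ)) (D : ℝ) : Prop :=
  Integrable (fun p : (S → ℝ) × (S → ℝ) => mseDistortion p.1 p.2) (μ ⊗ₘ κ) ∧
    ∫ p, mseDistortion p.1 p.2 ∂(μ ⊗ₘ κ) ≤ D

/-- The rate-distortion function `R(D) = inf I(X; X̂)` over all reproduction (Markov) kernels with
`E[d(X, X̂)] ≤ D`, for a source of law `μ`. It is `∞` if there is no such kernel. -/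
def rateDistortion {d : ℕ} {S : Finset (Fin d → ℤ)} (μ : Measure (S → ℝ)) (D : ℝ) : ℝ≥0∞ :=
  ⨅ (κ : Kernel (S → ℝ) (S → ℝ)) (_ : IsMarkovKernel κ) (_ : MeetsDistortion μ κ D),
    mutualInfo μ κ

/-- The reproduction kernel `κ` achieves `R(D)`. -/
structure IsAchievingKernel {d : ℕ} {S : Finset (Fin d → ℤ)} (μ : Measure (S → ℝ)) (D : ℝ)
    (κ : Kernel (S → ℝ) (S → ℝ)) : Prop where
  isMarkov : IsMarkovKernel κ
  meets : MeetsDistortion μ κ D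
  mutualInfo_eq : mutualInfo μ κ = rateDistortion μ D

/-- `λ* = -R'(D)`. -/
def rdSlope {d : ℕ} {S : Finset (Fin d → ℤ)} (μ : Measure (S → ℝ)) (D : ℝ) : ℝ :=
  -deriv (fun t => (rateDistortion μ t).toReal) D

/-- The distortion-tilted information density
`ȷ(x, D) = -log E_{X̂ ∼ P*}[exp(λ* (D - d(x, X̂)))]`, where `P*` is the output marginal of the
reproduction kernel `κ` under the source law `μ`. -/
def tiltedInfo {d : ℕ} {S : Finset (Fin d → ℤ)} (μ : Measure (S → ℝ))
    (κ : Kernel (S → ℝ) (S → ℝ)) (D : ℝ) (x : S → ℝ) : ℝ :=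
  -Real.log (∫ y, Real.exp (rdSlope μ D * (D - mseDistortion x y)) ∂(κ ∘ₘ μ))

end

/-!
The converse is a Markov inequality and a union bound over the `∏ r, M r` codewords, once the
following optimality condition is known.  Let `μ` be the law of the source, `q*` the output law of
the optimal kernel, `λ = rdSlope μ D` and `Z_q(x) = ∫ exp(-λ d(x, y)) dq(y)`.  Then
`∫ exp(-λ d(x, y)) / Z_{q*}(x) dμ(x) ≤ 1` for *every* reproduction `y`
(`lintegral_exp_div_partitionFn_le_one`).  Since `exp ȷ(x, D) = exp(-λ D) / Z_{q*}(x)` and `λ ≥ 0`,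
on the event `ȷ(X, D) ≥ log M + γ`, `d(X, y) ≤ D` the integrand is at least `M exp γ`, so that event
has probability at most `exp(-γ) / M`.

The optimality condition comes from a variational argument on couplings `ρ` of `μ` with an output.

* For each output law `q`, the functional `klDiv ρ (μ × q) + λ ∫ d dρ` is minimized by the Gibbs
  coupling, whose density with respect to `μ × q` is `exp(-λ d) / Z_q`; the minimum is
  `-∫ log Z_q dμ` (`klDiv_gibbsCoupling`, `neg_integral_log_partitionFn_le`).
* The optimal kernel minimizes this functional over all `ρ` and `q`
  (`rateDistortion_add_slope_le`).  This uses differentiability of the rate-distortion function,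
  joint convexity of the relative entropy (`klDiv_add_add_le`), and the fact that the mutual
  information is the least divergence from a product measure (`klDiv_prod_snd_le`).

Hence `q*` maximizes `q ↦ ∫ log Z_q dμ`.  Comparing `q*` with `(1 - ε) q* + ε δ_y` and letting
`ε → 0` gives the condition (`lintegral_le_one_of_integral_log_mix_nonpos`).

Of the Gaussian hypothesis only the finiteness of second moments enters: it makes `log Z_{q*}`
integrable.
-/

/-! ### Relative entropy -/

section Divergence

open InformationTheory

/-- Joint subadditivity of the relative entropy; with its homogeneity `klDiv_smul_same` this is
joint convexity.  The two pairs of measures are put side by side on `α ⊕ α`, where the divergence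
is additive, and the folding map `α ⊕ α → α` can only decrease it. -/
theorem klDiv_add_add_le {α : Type*} [MeasurableSpace α] (P P' Q Q' : Measure α)
    [IsFiniteMeasure P] [IsFiniteMeasure P'] [IsFiniteMeasure Q] [IsFiniteMeasure Q'] :
    klDiv (P + P') (Q + Q') ≤ klDiv P Q + klDiv P' Q' := by
  by_cases hPQ : P ≪ Q
  swap
  · simp [hPQ]
  by_cases hPQ' : P' ≪ Q'
  swap
  · simp [hPQ']
  set F : α ⊕ α → ℝ≥0∞ := Sum.elim (P.rnDeriv Q) (P'.rnDeriv Q') with hF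
  have hFm : Measurable F := Measurable.sumElim (by fun_prop) (by fun_prop)
  set Ps : Measure (α ⊕ α) := P.map Sum.inl + P'.map Sum.inr with hPs
  set Qs : Measure (α ⊕ α) := Q.map Sum.inl + Q'.map Sum.inr with hQs
  have hdens : Ps = Qs.withDensity F := by
    ext s hs
    have h1 : MeasurableSet (Sum.inl ⁻¹' s : Set α) := measurable_inl hs
    have h2 : MeasurableSet (Sum.inr ⁻¹' s : Set α) := measurable_inr hs
    rw [withDensity_apply _ hs, hQs, Measure.restrict_add, lintegral_add_measure,
      Measure.restrict_map measurable_inl hs, Measure.restrict_map measurable_inr hs,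
      lintegral_map hFm measurable_inl, lintegral_map hFm measurable_inr, hPs, Measure.add_apply,
      Measure.map_apply measurable_inl hs, Measure.map_apply measurable_inr hs]
    simp only [hF, Sum.elim_inl, Sum.elim_inr]
    rw [Measure.setLIntegral_rnDeriv hPQ, Measure.setLIntegral_rnDeriv hPQ']
  have hsum : klDiv Ps Qs = klDiv P Q + klDiv P' Q' := by
    have hac : Ps ≪ Qs := hdens ▸ withDensity_absolutelyContinuous _ _
    have hrn : Ps.rnDeriv Qs =ᵐ[Qs] F := by
      rw [hdens]; exact Measure.rnDeriv_withDensity _ hFm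
    have hm : Measurable fun z => ENNReal.ofReal (klFun (F z).toReal) := by fun_prop
    rw [klDiv_eq_lintegral_klFun_of_ac hac, klDiv_eq_lintegral_klFun_of_ac hPQ,
      klDiv_eq_lintegral_klFun_of_ac hPQ']
    calc ∫⁻ z, ENNReal.ofReal (klFun (Ps.rnDeriv Qs z).toReal) ∂Qs
        = ∫⁻ z, ENNReal.ofReal (klFun (F z).toReal) ∂Qs := by
          refine lintegral_congr_ae ?_
          filter_upwards [hrn] with z hz
          rw [hz]
      _ = _ := by
          rw [hQs, lintegral_add_measure, lintegral_map hm measurable_inl,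
            lintegral_map hm measurable_inr]
          simp [hF]
  have hfold : Measurable (Sum.elim id id : α ⊕ α → α) :=
    Measurable.sumElim measurable_id measurable_id
  have hmap : ∀ R R' : Measure α,
      (R.map Sum.inl + R'.map Sum.inr).map (Sum.elim id id : α ⊕ α → α) = R + R' := by
    intro R R'
    rw [Measure.map_add _ _ hfold, Measure.map_map hfold measurable_inl,
      Measure.map_map hfold measurable_inr]
    simp
  rw [← hsum, ← hmap P P', ← hmap Q Q']
  exact klDiv_map_le _ _ hfold

/-- Relative entropy is invariant under exchanging the two coordinates. -/
theorem klDiv_map_swap {α β : Type*} [MeasurableSpace α] [MeasurableSpace β]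
    (ρ σ : Measure (α × β)) [IsFiniteMeasure ρ] [IsFiniteMeasure σ] :
    klDiv (ρ.map Prod.swap) (σ.map Prod.swap) = klDiv ρ σ := by
  refine le_antisymm (klDiv_map_le _ _ measurable_swap) ?_
  have h := klDiv_map_le (ρ.map Prod.swap) (σ.map Prod.swap)
    (measurable_swap (α := β) (β := α))
  simpa [Measure.map_map measurable_swap measurable_swap] using h

/-- The mutual information of a coupling is the least divergence from a product measure with the
same first marginal: replacing the second marginal `ρ.snd` by `q` adds `klDiv ρ.snd q`. -/
theorem klDiv_prod_snd_le {α β : Type*} [MeasurableSpace α] [MeasurableSpace β]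
    [StandardBorelSpace α] [Nonempty α] (ρ : Measure (α × β)) [IsProbabilityMeasure ρ]
    (μ : Measure α) [IsProbabilityMeasure μ] (q : Measure β) [IsProbabilityMeasure q] :
    klDiv ρ (μ.prod ρ.snd) ≤ klDiv ρ (μ.prod q) := by
  have hprod : ∀ r : Measure β, SFinite r →
      (μ.prod r).map Prod.swap = r ⊗ₘ Kernel.const β μ := by
    intro r _
    rw [Measure.prod_swap, Measure.compProd_const]
  have hρ : ρ.map Prod.swap = ρ.snd ⊗ₘ (ρ.map Prod.swap).condKernel := by
    have h := (ρ.map Prod.swap).disintegrate (ρ.map Prod.swap).condKernel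
    rw [Measure.fst_map_swap] at h
    exact h.symm
  have : IsProbabilityMeasure (ρ.map Prod.swap) :=
    Measure.isProbabilityMeasure_map measurable_swap.aemeasurable
  rw [← klDiv_map_swap ρ (μ.prod ρ.snd), ← klDiv_map_swap ρ (μ.prod q), hprod _ inferInstance,
    hprod _ inferInstance, hρ, klDiv_compProd_eq_add ρ.snd q]
  exact le_add_self

/-- The easy half of the Donsker-Varadhan formula. -/
theorem integral_sub_log_le_toReal_klDiv {α : Type*} [MeasurableSpace α] (P Q : Measure α)
    [IsProbabilityMeasure P] [IsProbabilityMeasure Q] (hPQ : klDiv P Q ≠ ∞) {g : α → ℝ}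
    (hg : Integrable g P) (hexp : Integrable (fun x => Real.exp (g x)) Q) :
    ∫ x, g x ∂P - Real.log (∫ x, Real.exp (g x) ∂Q) ≤ (klDiv P Q).toReal := by
  obtain ⟨hac, hint⟩ := klDiv_ne_top_iff.1 hPQ
  have := isProbabilityMeasure_tilted hexp
  have h := integral_llr_add_sub_measure_univ_nonneg
    (hac.trans (absolutelyContinuous_tilted hexp)) (integrable_llr_tilted_right hac hg hint hexp)
  rw [integral_llr_tilted_right hac hg hexp hint] at h
  rw [toReal_klDiv_of_measure_eq hac (by simp)]
  simp only [probReal_univ] at h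
  linarith

end Divergence

/-! ### Gibbs couplings -/

section Gibbs

open InformationTheory

variable {α β : Type*} [MeasurableSpace α] [MeasurableSpace β]

/-- The partition function `Z_q(x) = ∫ exp(-c(x, y)) dq(y)` of the cost `c` and the reference
output law `q`. -/
noncomputable def partitionFn (c : α × β → ℝ) (q : Measure β) (x : α) : ℝ :=
  ∫ y, Real.exp (-c (x, y)) ∂q

/-- The exponent `-c(x, y) - log Z_q(x)` of the normalized Gibbs density. -/
noncomputable def gibbsExponent (c : α × β → ℝ) (q : Measure β) (p : α × β) : ℝ :=
  -c p - Real.log (partitionFn c q p.1)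

/-- The joint law of an input `x ∼ μ` and an output drawn from the Gibbs law
`exp(-c(x, y)) / Z_q(x) dq(y)`. -/
noncomputable def gibbsCoupling (c : α × β → ℝ) (μ : Measure α) (q : Measure β) :
    Measure (α × β) :=
  (μ.prod q).tilted (gibbsExponent c q)

theorem integrable_exp_neg_cost {c : α × β → ℝ} (hc : Measurable c) (hc0 : ∀ p, 0 ≤ c p)
    (q : Measure β) [IsFiniteMeasure q] (x : α) :
    Integrable (fun y => Real.exp (-c (x, y))) q := by
  have hm : Measurable fun y => Real.exp (-c (x, y)) := by fun_prop
  refine Integrable.of_bound hm.aestronglyMeasurable 1 (ae_of_all _ fun y => ?_)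
  rw [Real.norm_eq_abs, Real.abs_exp]
  exact Real.exp_le_one_iff.2 (neg_nonpos.2 (hc0 _))

theorem partitionFn_pos {c : α × β → ℝ} (hc : Measurable c) (hc0 : ∀ p, 0 ≤ c p)
    (q : Measure β) [IsProbabilityMeasure q] (x : α) : 0 < partitionFn c q x :=
  integral_exp_pos (integrable_exp_neg_cost hc hc0 q x)

theorem partitionFn_le_one {c : α × β → ℝ} (hc : Measurable c) (hc0 : ∀ p, 0 ≤ c p)
    (q : Measure β) [IsProbabilityMeasure q] (x : α) : partitionFn c q x ≤ 1 := by
  calc partitionFn c q x ≤ ∫ _, (1 : ℝ) ∂q :=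
        integral_mono (integrable_exp_neg_cost hc hc0 q x) (integrable_const _)
          fun y => Real.exp_le_one_iff.2 (neg_nonpos.2 (hc0 _))
    _ = 1 := by simp

theorem measurable_partitionFn {c : α × β → ℝ} (hc : Measurable c) (q : Measure β) [SFinite q] :
    Measurable (partitionFn c q) := by
  have h : Measurable fun p : α × β => Real.exp (-c p) := by fun_prop
  exact h.stronglyMeasurable.integral_prod_right'.measurable

theorem measurable_gibbsExponent {c : α × β → ℝ} (hc : Measurable c) (q : Measure β)
    [SFinite q] : Measurable (gibbsExponent c q) :=
  hc.neg.sub ((measurable_partitionFn hc q).comp measurable_fst).log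

theorem exp_gibbsExponent {c : α × β → ℝ} (hc : Measurable c) (hc0 : ∀ p, 0 ≤ c p)
    (q : Measure β) [IsProbabilityMeasure q] (p : α × β) :
    Real.exp (gibbsExponent c q p) = Real.exp (-c p) / partitionFn c q p.1 := by
  rw [gibbsExponent, Real.exp_sub, Real.exp_log (partitionFn_pos hc hc0 q p.1)]

theorem integrable_exp_gibbsExponent_slice {c : α × β → ℝ} (hc : Measurable c)
    (hc0 : ∀ p, 0 ≤ c p) (q : Measure β) [IsProbabilityMeasure q] (x : α) :
    Integrable (fun y => Real.exp (gibbsExponent c q (x, y))) q := by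
  simp_rw [exp_gibbsExponent hc hc0]
  exact (integrable_exp_neg_cost hc hc0 q x).div_const _

theorem integral_exp_gibbsExponent_slice {c : α × β → ℝ} (hc : Measurable c)
    (hc0 : ∀ p, 0 ≤ c p) (q : Measure β) [IsProbabilityMeasure q] (x : α) :
    ∫ y, Real.exp (gibbsExponent c q (x, y)) ∂q = 1 := by
  simp_rw [exp_gibbsExponent hc hc0]
  rw [integral_div]
  exact div_self (partitionFn_pos hc hc0 q x).ne'

theorem lintegral_exp_gibbsExponent_slice {c : α × β → ℝ} (hc : Measurable c)
    (hc0 : ∀ p, 0 ≤ c p) (q : Measure β) [IsProbabilityMeasure q] (x : α) :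
    ∫⁻ y, ENNReal.ofReal (Real.exp (gibbsExponent c q (x, y))) ∂q = 1 := by
  rw [← ofReal_integral_eq_lintegral_ofReal (integrable_exp_gibbsExponent_slice hc hc0 q x)
    (ae_of_all _ fun y => (Real.exp_pos _).le), integral_exp_gibbsExponent_slice hc hc0,
    ENNReal.ofReal_one]

theorem integrable_exp_gibbsExponent {c : α × β → ℝ} (hc : Measurable c)
    (hc0 : ∀ p, 0 ≤ c p) (μ : Measure α) [IsProbabilityMeasure μ] (q : Measure β)
    [IsProbabilityMeasure q] :
    Integrable (fun p => Real.exp (gibbsExponent c q p)) (μ.prod q) := by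
  have hm := measurable_gibbsExponent hc q
  refine (lintegral_ofReal_ne_top_iff_integrable (by fun_prop)
    (ae_of_all _ fun p => (Real.exp_pos _).le)).1 ?_
  rw [lintegral_prod _ (by fun_prop)]
  simp [lintegral_exp_gibbsExponent_slice hc hc0]

theorem integral_exp_gibbsExponent {c : α × β → ℝ} (hc : Measurable c)
    (hc0 : ∀ p, 0 ≤ c p) (μ : Measure α) [IsProbabilityMeasure μ] (q : Measure β)
    [IsProbabilityMeasure q] :
    ∫ p, Real.exp (gibbsExponent c q p) ∂(μ.prod q) = 1 := by
  rw [integral_prod _ (integrable_exp_gibbsExponent hc hc0 μ q)]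
  simp [integral_exp_gibbsExponent_slice hc hc0]

theorem isProbabilityMeasure_gibbsCoupling {c : α × β → ℝ} (hc : Measurable c)
    (hc0 : ∀ p, 0 ≤ c p) (μ : Measure α) [IsProbabilityMeasure μ] (q : Measure β)
    [IsProbabilityMeasure q] : IsProbabilityMeasure (gibbsCoupling c μ q) :=
  isProbabilityMeasure_tilted (integrable_exp_gibbsExponent hc hc0 μ q)

theorem fst_gibbsCoupling {c : α × β → ℝ} (hc : Measurable c)
    (hc0 : ∀ p, 0 ≤ c p) (μ : Measure α) [IsProbabilityMeasure μ] (q : Measure β)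
    [IsProbabilityMeasure q] : (gibbsCoupling c μ q).fst = μ := by
  have hm := measurable_gibbsExponent hc q
  ext s hs
  rw [Measure.fst_apply hs, gibbsCoupling, tilted_apply, integral_exp_gibbsExponent hc hc0,
    ← Set.prod_univ, ← Measure.prod_restrict, Measure.restrict_univ,
    lintegral_prod _ (by fun_prop)]
  simp [lintegral_exp_gibbsExponent_slice hc hc0]

/-- Jensen's inequality for the partition function gives `0 ≤ -log Z_q(x) ≤ ∫ c(x, y) dq(y)`. -/
theorem integrable_log_partitionFn {c : α × β → ℝ} (hc : Measurable c) (hc0 : ∀ p, 0 ≤ c p)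
    (μ : Measure α) [IsProbabilityMeasure μ] (q : Measure β) [IsProbabilityMeasure q]
    (hint : Integrable c (μ.prod q)) :
    Integrable (fun x => Real.log (partitionFn c q x)) μ := by
  refine hint.integral_prod_left.mono' (measurable_partitionFn hc q).log.aestronglyMeasurable ?_
  filter_upwards [hint.prod_right_ae] with x hx
  have hpos := partitionFn_pos hc hc0 q x
  rw [Real.norm_eq_abs, abs_of_nonpos (Real.log_nonpos hpos.le (partitionFn_le_one hc hc0 q x)),
    neg_le, Real.le_log_iff_exp_le hpos]
  set t := ∫ y, c (x, y) ∂q with ht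
  -- Integrate the tangent line inequality for `exp` at `-t`, where `t` is the mean cost.
  have hsub : Integrable (fun y => t - c (x, y)) q := (integrable_const t).sub hx
  have hi : Integrable (fun y => Real.exp (-t) * (t - c (x, y) + 1)) q :=
    (hsub.add (integrable_const 1)).const_mul _
  have hle : ∫ y, Real.exp (-t) * (t - c (x, y) + 1) ∂q ≤ partitionFn c q x := by
    refine integral_mono hi (integrable_exp_neg_cost hc hc0 q x) fun y => ?_
    have h := Real.add_one_le_exp (t - c (x, y))
    calc Real.exp (-t) * (t - c (x, y) + 1) ≤ Real.exp (-t) * Real.exp (t - c (x, y)) := by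
          gcongr
      _ = Real.exp (-c (x, y)) := by rw [← Real.exp_add]; ring_nf
  refine le_trans (le_of_eq ?_) hle
  rw [integral_const_mul, integral_add hsub (integrable_const 1),
    integral_sub (integrable_const t) hx]
  simp [ht]

/-- The mean cost under each Gibbs law is at most `-log Z_q(x)`, since the divergence of the Gibbs
law from `q` is nonnegative. -/
theorem integrable_cost_gibbsCoupling {c : α × β → ℝ} (hc : Measurable c) (hc0 : ∀ p, 0 ≤ c p)
    (μ : Measure α) [IsProbabilityMeasure μ] (q : Measure β) [IsProbabilityMeasure q]
    (hlog : Integrable (fun x => Real.log (partitionFn c q x)) μ) :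
    Integrable c (gibbsCoupling c μ q) := by
  have hm := measurable_gibbsExponent hc q
  refine (lintegral_ofReal_ne_top_iff_integrable hc.aestronglyMeasurable
    (ae_of_all _ hc0)).1 ?_
  rw [gibbsCoupling, lintegral_tilted, integral_exp_gibbsExponent hc hc0,
    lintegral_prod _ (by fun_prop)]
  refine ne_top_of_le_ne_top
    (lintegral_ofReal_ne_top_iff_integrable hlog.neg.1 (ae_of_all _ fun x => ?_) |>.2 hlog.neg)
    (lintegral_mono fun x => ?_)
  · exact neg_nonneg.2 (Real.log_nonpos (partitionFn_pos hc hc0 q x).le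
      (partitionFn_le_one hc hc0 q x))
  · have hi := integrable_exp_gibbsExponent_slice hc hc0 q x
    set L := Real.log (partitionFn c q x) with hL
    have hpt : ∀ y, Real.exp (gibbsExponent c q (x, y)) * c (x, y)
        ≤ (1 - Real.exp (gibbsExponent c q (x, y)))
          + Real.exp (gibbsExponent c q (x, y)) * (-L) := by
      intro y
      have hkl := klFun_nonneg (Real.exp_pos (gibbsExponent c q (x, y))).le
      rw [klFun_apply, Real.log_exp] at hkl
      have hg : gibbsExponent c q (x, y) = -c (x, y) - L := rfl
      have hg' : Real.exp (gibbsExponent c q (x, y)) * gibbsExponent c q (x, y)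
        = Real.exp (gibbsExponent c q (x, y)) * (-c (x, y) - L) := by rw [hg]
      nlinarith
    have hsub : Integrable (fun y => 1 - Real.exp (gibbsExponent c q (x, y))) q :=
      (integrable_const 1).sub hi
    have hi2 : Integrable (fun y => (1 - Real.exp (gibbsExponent c q (x, y)))
          + Real.exp (gibbsExponent c q (x, y)) * (-L)) q :=
      hsub.add (hi.mul_const _)
    calc ∫⁻ y, ENNReal.ofReal (Real.exp (gibbsExponent c q (x, y)) / 1)
            * ENNReal.ofReal (c (x, y)) ∂q
        ≤ ∫⁻ y, ENNReal.ofReal ((1 - Real.exp (gibbsExponent c q (x, y)))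
          + Real.exp (gibbsExponent c q (x, y)) * (-L)) ∂q := by
          refine lintegral_mono fun y => ?_
          rw [div_one, ← ENNReal.ofReal_mul (Real.exp_pos _).le]
          exact ENNReal.ofReal_le_ofReal (hpt y)
      _ = ENNReal.ofReal (-L) := by
          rw [← ofReal_integral_eq_lintegral_ofReal hi2 (ae_of_all _ fun y =>
            (mul_nonneg (Real.exp_pos _).le (hc0 _)).trans (hpt y)),
            integral_add hsub (hi.mul_const _),
            integral_sub (integrable_const 1) hi, integral_mul_const,
            integral_exp_gibbsExponent_slice hc hc0]
          simp

theorem integrable_gibbsExponent {c : α × β → ℝ} {μ : Measure α} {q : Measure β}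
    {ρ : Measure (α × β)} (hρ : ρ.fst = μ) (hcρ : Integrable c ρ)
    (hlog : Integrable (fun x => Real.log (partitionFn c q x)) μ) :
    Integrable (gibbsExponent c q) ρ := by
  rw [← hρ] at hlog
  exact hcρ.neg.sub (hlog.comp_measurable measurable_fst)

theorem integral_gibbsExponent {c : α × β → ℝ} {μ : Measure α} {q : Measure β}
    {ρ : Measure (α × β)} (hρ : ρ.fst = μ) (hcρ : Integrable c ρ)
    (hlog : Integrable (fun x => Real.log (partitionFn c q x)) μ) :
    ∫ p, gibbsExponent c q p ∂ρ
      = -∫ p, c p ∂ρ - ∫ x, Real.log (partitionFn c q x) ∂μ := by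
  subst hρ
  have h2 : Integrable (fun p : α × β => Real.log (partitionFn c q p.1)) ρ :=
    hlog.comp_measurable measurable_fst
  have h3 : ∫ x, Real.log (partitionFn c q x) ∂ρ.fst
      = ∫ p : α × β, Real.log (partitionFn c q p.1) ∂ρ :=
    integral_map measurable_fst.aemeasurable hlog.1
  rw [h3, ← integral_neg]
  exact integral_sub hcρ.neg h2

/-- The log-density of the Gibbs coupling is `gibbsExponent`, so its divergence from `μ.prod q` and
its mean cost add up to `-∫ log Z_q dμ`. -/
theorem klDiv_gibbsCoupling {c : α × β → ℝ} (hc : Measurable c) (hc0 : ∀ p, 0 ≤ c p)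
    (μ : Measure α) [IsProbabilityMeasure μ] (q : Measure β) [IsProbabilityMeasure q]
    (hlog : Integrable (fun x => Real.log (partitionFn c q x)) μ) :
    klDiv (gibbsCoupling c μ q) (μ.prod q) ≠ ∞ ∧
      (klDiv (gibbsCoupling c μ q) (μ.prod q)).toReal
        + ∫ p, c p ∂(gibbsCoupling c μ q) = -∫ x, Real.log (partitionFn c q x) ∂μ := by
  have hfst := fst_gibbsCoupling hc hc0 μ q
  have hcint := integrable_cost_gibbsCoupling hc hc0 μ q hlog
  have hprob := isProbabilityMeasure_gibbsCoupling hc hc0 μ q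
  have hac : gibbsCoupling c μ q ≪ μ.prod q := tilted_absolutelyContinuous _ _
  have hllr : llr (gibbsCoupling c μ q) (μ.prod q) =ᵐ[gibbsCoupling c μ q]
      gibbsExponent c q := by
    refine hac.ae_eq ?_
    filter_upwards [log_rnDeriv_tilted_left_self (integrable_exp_gibbsExponent hc hc0 μ q)]
      with p hp
    rw [integral_exp_gibbsExponent hc hc0, Real.log_one, sub_zero] at hp
    exact hp
  refine ⟨klDiv_ne_top hac ((integrable_congr hllr).2
    (integrable_gibbsExponent hfst hcint hlog)), ?_⟩
  rw [toReal_klDiv_of_measure_eq hac (by simp), integral_congr_ae hllr,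
    integral_gibbsExponent hfst hcint hlog]
  ring

/-- Among all couplings of `μ`, the sum of the divergence from `μ.prod q` and the mean cost is at
least `-∫ log Z_q dμ`, the value attained by the Gibbs coupling. -/
theorem neg_integral_log_partitionFn_le {c : α × β → ℝ} (hc : Measurable c)
    (hc0 : ∀ p, 0 ≤ c p) (μ : Measure α) [IsProbabilityMeasure μ] (q : Measure β)
    [IsProbabilityMeasure q] (hlog : Integrable (fun x => Real.log (partitionFn c q x)) μ)
    (ρ : Measure (α × β)) [IsProbabilityMeasure ρ] (hρ : ρ.fst = μ) (hcρ : Integrable c ρ)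
    (hkl : klDiv ρ (μ.prod q) ≠ ∞) :
    -∫ x, Real.log (partitionFn c q x) ∂μ
      ≤ (klDiv ρ (μ.prod q)).toReal + ∫ p, c p ∂ρ := by
  have h := integral_sub_log_le_toReal_klDiv ρ (μ.prod q) hkl
    (integrable_gibbsExponent hρ hcρ hlog) (integrable_exp_gibbsExponent hc hc0 μ q)
  rw [integral_exp_gibbsExponent hc hc0, integral_gibbsExponent hρ hcρ hlog] at h
  simp only [Real.log_one] at h
  linarith

end Gibbs

/-! ### The rate-distortion function and its slope -/

section RateDistortion

open InformationTheory Filter Topology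

variable {d : ℕ} {S : Finset (Fin d → ℤ)}

theorem mseDistortion_nonneg (x y : S → ℝ) : 0 ≤ mseDistortion x y :=
  mul_nonneg (by positivity) (Finset.sum_nonneg fun _ _ => sq_nonneg _)

theorem measurable_mseDistortion :
    Measurable fun p : (S → ℝ) × (S → ℝ) => mseDistortion p.1 p.2 := by
  unfold mseDistortion
  fun_prop

/-- The rate-distortion function in terms of couplings: every joint law with input marginal `μ`
disintegrates into a reproduction kernel, and any output law `q` may serve as reference. -/
theorem rateDistortion_le_klDiv {μ : Measure (S → ℝ)} [IsProbabilityMeasure μ]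
    {ρ : Measure ((S → ℝ) × (S → ℝ))} [IsProbabilityMeasure ρ] (hρ : ρ.fst = μ)
    (q : Measure (S → ℝ)) [IsProbabilityMeasure q]
    (hint : Integrable (fun p => mseDistortion p.1 p.2) ρ) {t : ℝ}
    (ht : ∫ p, mseDistortion p.1 p.2 ∂ρ ≤ t) :
    rateDistortion μ t ≤ klDiv ρ (μ.prod q) := by
  have hdis : μ ⊗ₘ ρ.condKernel = ρ := by
    rw [← hρ]; exact ρ.disintegrate ρ.condKernel
  refine le_trans ?_ (klDiv_prod_snd_le ρ μ q)
  refine iInf_le_of_le ρ.condKernel (iInf_le_of_le inferInstance (iInf_le_of_le ?_ ?_))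
  · unfold MeetsDistortion
    rw [hdis]
    exact ⟨hint, ht⟩
  · rw [mutualInfo, ← Measure.snd_compProd, hdis]

theorem antitone_rateDistortion (μ : Measure (S → ℝ)) : Antitone (rateDistortion μ) :=
  fun _ _ hst => le_iInf fun κ => le_iInf fun h1 => le_iInf fun h2 =>
    iInf_le_of_le κ (iInf_le_of_le h1 (iInf_le_of_le ⟨h2.1, h2.2.trans hst⟩ le_rfl))

theorem nonneg_of_hasDerivAt_of_le_right {f : ℝ → ℝ} {f' : ℝ} (hf : HasDerivAt f f' 0)
    (hle : ∀ t, 0 < t → t < 1 → f 0 ≤ f t) : 0 ≤ f' := by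
  refine ge_of_tendsto hf.tendsto_slope_zero_right ?_
  filter_upwards [Ioo_mem_nhdsGT (zero_lt_one (α := ℝ))] with t ht
  rw [zero_add, smul_eq_mul]
  exact mul_nonneg (inv_nonneg.2 ht.1.le) (sub_nonneg.2 (hle t ht.1 ht.2))

/-- Only points to the right of `D` are compared, where the rate-distortion function is finite; to
the left it may be infinite, with real value `0`. -/
theorem rdSlope_nonneg {μ : Measure (S → ℝ)} {D : ℝ} (hfin : rateDistortion μ D ≠ ∞)
    (hdiff : DifferentiableAt ℝ (fun t => (rateDistortion μ t).toReal) D) :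
    0 ≤ rdSlope μ D := by
  have h1 : HasDerivAt (fun t : ℝ => D + t) 1 0 := (hasDerivAt_id (0 : ℝ)).const_add D
  have h2 : HasDerivAt (fun t => (rateDistortion μ t).toReal)
      (deriv (fun t => (rateDistortion μ t).toReal) D) (D + 0) := by
    rw [add_zero]; exact hdiff.hasDerivAt
  have h3 := (h2.comp (0 : ℝ) h1).neg
  rw [mul_one] at h3
  refine nonneg_of_hasDerivAt_of_le_right h3 fun t ht _ => ?_
  simp only [Pi.neg_apply, Function.comp_apply, add_zero, neg_le_neg_iff]
  exact ENNReal.toReal_mono hfin (antitone_rateDistortion μ (by linarith))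

/-- The supporting line of the rate-distortion function at `D`: no coupling of `μ` does better than
the optimal kernel for the Lagrangian with multiplier `rdSlope μ D`.  Mixing the optimal coupling
with a small proportion `η` of `ρ` moves the pair (distortion, rate) below the chord to that of
`ρ`, and the claim is the comparison of derivatives at `η = 0`. -/
theorem rateDistortion_add_slope_le {μ : Measure (S → ℝ)} [IsProbabilityMeasure μ] {D : ℝ}
    (hfin : rateDistortion μ D ≠ ∞)
    (hdiff : DifferentiableAt ℝ (fun t => (rateDistortion μ t).toReal) D)
    {κ : Kernel (S → ℝ) (S → ℝ)} (hκ : IsAchievingKernel μ D κ)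
    {ρ : Measure ((S → ℝ) × (S → ℝ))} [IsProbabilityMeasure ρ] (hρ : ρ.fst = μ)
    (q : Measure (S → ℝ)) [IsProbabilityMeasure q]
    (hint : Integrable (fun p => mseDistortion p.1 p.2) ρ) (hkl : klDiv ρ (μ.prod q) ≠ ∞) :
    (rateDistortion μ D).toReal + rdSlope μ D * D
      ≤ (klDiv ρ (μ.prod q)).toReal + rdSlope μ D * ∫ p, mseDistortion p.1 p.2 ∂ρ := by
  have := hκ.isMarkov
  set r := fun t => (rateDistortion μ t).toReal with hr
  set D' := ∫ p, mseDistortion p.1 p.2 ∂ρ with hD'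
  set I' := (klDiv ρ (μ.prod q)).toReal with hI'
  have hchord : ∀ η : ℝ, 0 < η → η < 1 →
      r (D + η * (D' - D)) ≤ (1 - η) * r D + η * I' := by
    intro η h0 h1
    lift η to NNReal using h0.le
    obtain ⟨θ, hθ⟩ : ∃ θ : NNReal, (θ : ℝ) = 1 - η := ⟨⟨1 - η, by linarith⟩, rfl⟩
    have hsum : θ + η = 1 := by
      rw [← NNReal.coe_inj]; push_cast; rw [hθ]; ring
    set σ : Measure ((S → ℝ) × (S → ℝ)) := θ • (μ ⊗ₘ κ) + η • ρ with hσ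
    set q' : Measure (S → ℝ) := θ • (κ ∘ₘ μ) + η • q with hq'
    have hσp : IsProbabilityMeasure σ := ⟨by
      simp only [hσ, Measure.add_apply, Measure.smul_apply, measure_univ]
      simp only [ENNReal.smul_def, smul_eq_mul, mul_one]
      exact_mod_cast hsum⟩
    have hqp : IsProbabilityMeasure q' := ⟨by
      simp only [hq', Measure.add_apply, Measure.smul_apply, measure_univ]
      simp only [ENNReal.smul_def, smul_eq_mul, mul_one]
      exact_mod_cast hsum⟩
    have hσfst : σ.fst = μ := by
      have h : (μ ⊗ₘ κ).fst = μ := Measure.fst_compProd μ κ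
      unfold Measure.fst at h hρ ⊢
      rw [hσ, Measure.map_add _ _ measurable_fst, Measure.map_smul, Measure.map_smul, h, hρ,
        ← add_smul, hsum, one_smul]
    have hi1 : Integrable (fun p => mseDistortion p.1 p.2) (θ • (μ ⊗ₘ κ)) :=
      hκ.meets.1.smul_measure_nnreal
    have hi2 : Integrable (fun p => mseDistortion p.1 p.2) (η • ρ) := hint.smul_measure_nnreal
    have hDσ : ∫ p, mseDistortion p.1 p.2 ∂σ ≤ D + η * (D' - D) := by
      rw [hσ, integral_add_measure hi1 hi2, integral_smul_nnreal_measure,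
        integral_smul_nnreal_measure, NNReal.smul_def, NNReal.smul_def, smul_eq_mul, smul_eq_mul,
        hθ, ← hD']
      have := mul_le_mul_of_nonneg_left hκ.meets.2 (sub_nonneg.2 h1.le)
      linarith
    have hprod : μ.prod q' = θ • μ.prod (κ ∘ₘ μ) + η • μ.prod q := by
      rw [hq', Measure.prod_add]
      congr 1 <;> exact Measure.prod_smul_right _
    have hle : rateDistortion μ (D + η * (D' - D))
        ≤ θ * rateDistortion μ D + η * klDiv ρ (μ.prod q) := by
      calc rateDistortion μ (D + η * (D' - D)) ≤ klDiv σ (μ.prod q') :=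
            rateDistortion_le_klDiv hσfst q' (hi1.add_measure hi2) hDσ
        _ ≤ klDiv (θ • (μ ⊗ₘ κ)) (θ • μ.prod (κ ∘ₘ μ)) + klDiv (η • ρ) (η • μ.prod q) := by
            rw [hprod]; exact klDiv_add_add_le _ _ _ _
        _ = θ * rateDistortion μ D + η * klDiv ρ (μ.prod q) := by
            rw [klDiv_smul_same, klDiv_smul_same, ← hκ.mutualInfo_eq, mutualInfo]
    have hne1 : (θ : ℝ≥0∞) * rateDistortion μ D ≠ ∞ := ENNReal.mul_ne_top (by simp) hfin
    have hne2 : (η : ℝ≥0∞) * klDiv ρ (μ.prod q) ≠ ∞ := ENNReal.mul_ne_top (by simp) hkl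
    have := ENNReal.toReal_mono (ENNReal.add_ne_top.2 ⟨hne1, hne2⟩) hle
    rw [ENNReal.toReal_add hne1 hne2, ENNReal.toReal_mul, ENNReal.toReal_mul] at this
    simpa [hθ] using this
  have hr' : HasDerivAt r (-rdSlope μ D) (D + 0 * (D' - D)) := by
    rw [zero_mul, add_zero, rdSlope, neg_neg]; exact hdiff.hasDerivAt
  have hline : HasDerivAt (fun η : ℝ => D + η * (D' - D)) (D' - D) 0 := by
    simpa using ((hasDerivAt_id (0 : ℝ)).mul_const (D' - D)).const_add D
  have hrate : HasDerivAt (fun η : ℝ => r D + η * (I' - r D)) (I' - r D) 0 := by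
    simpa using ((hasDerivAt_id (0 : ℝ)).mul_const (I' - r D)).const_add (r D)
  have h := nonneg_of_hasDerivAt_of_le_right (hrate.sub (hr'.comp (0 : ℝ) hline))
    fun η h0 h1 => by
      have := hchord η h0 h1
      simp only [Pi.sub_apply, Function.comp_apply, zero_mul, add_zero, sub_self]
      linarith
  change r D + rdSlope μ D * D ≤ I' + rdSlope μ D * D'
  linarith

end RateDistortion

/-! ### Optimality of the output law -/

section Optimality

open InformationTheory Filter Topology

theorem partitionFn_mix_dirac {α β : Type*} [MeasurableSpace α] [MeasurableSpace β]
    {c : α × β → ℝ} (hc : Measurable c) (hc0 : ∀ p, 0 ≤ c p) (q : Measure β)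
    [IsProbabilityMeasure q] (θ ε : NNReal) (y : β) (x : α) :
    partitionFn c (θ • q + ε • Measure.dirac y) x
      = θ * partitionFn c q x + ε * Real.exp (-c (x, y)) := by
  have h1 := (integrable_exp_neg_cost hc hc0 q x).smul_measure_nnreal (c := θ)
  have h2 := (integrable_exp_neg_cost hc hc0 (Measure.dirac y) x).smul_measure_nnreal (c := ε)
  have hm : Measurable fun y => Real.exp (-c (x, y)) := by fun_prop
  rw [partitionFn, integral_add_measure h1 h2, integral_smul_nnreal_measure,
    integral_smul_nnreal_measure, integral_dirac' _ _ hm.stronglyMeasurable]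
  rfl

/-- If moving from the constant `1` towards `h` never increases the mean logarithm above zero, then
`h` has mean at most one.  The bound `log u ≥ 1 - 1 / u` turns the hypothesis into
`∫ h / (1 - ε + ε h) ≤ 1 / (1 - ε)`, and Fatou's lemma lets `ε → 0`. -/
theorem lintegral_le_one_of_integral_log_mix_nonpos {α : Type*} [MeasurableSpace α]
    (μ : Measure α) [IsProbabilityMeasure μ] {h : α → ℝ} (hm : Measurable h) (h0 : ∀ x, 0 ≤ h x)
    (hint : ∀ ε : ℝ, 0 < ε → ε < 1 → Integrable (fun x => Real.log (1 - ε + ε * h x)) μ)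
    (hlog : ∀ ε : ℝ, 0 < ε → ε < 1 → ∫ x, Real.log (1 - ε + ε * h x) ∂μ ≤ 0) :
    ∫⁻ x, ENNReal.ofReal (h x) ∂μ ≤ 1 := by
  have hbound : ∀ ε : ℝ, 0 < ε → ε < 1 →
      ∫⁻ x, ENNReal.ofReal (h x / (1 - ε + ε * h x)) ∂μ ≤ ENNReal.ofReal (1 / (1 - ε)) := by
    intro ε hε hε1
    have hden : ∀ x, 0 < 1 - ε + ε * h x := fun x => by
      have := mul_nonneg hε.le (h0 x); linarith
    have hfm : Measurable fun x => h x / (1 - ε + ε * h x) := by fun_prop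
    have hfi : Integrable (fun x => h x / (1 - ε + ε * h x)) μ := by
      refine Integrable.of_bound hfm.aestronglyMeasurable (1 / ε) (ae_of_all _ fun x => ?_)
      rw [Real.norm_of_nonneg (div_nonneg (h0 x) (hden x).le), div_le_div_iff₀ (hden x) hε]
      nlinarith
    rw [← ofReal_integral_eq_lintegral_ofReal hfi
      (ae_of_all _ fun x => div_nonneg (h0 x) (hden x).le)]
    refine ENNReal.ofReal_le_ofReal ?_
    have hpt : ∀ x, ε * (h x / (1 - ε + ε * h x))
        ≤ Real.log (1 - ε + ε * h x) + ε / (1 - ε) := by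
      intro x
      have h1 := Real.one_sub_inv_le_log_of_pos (hden x)
      have h2 : 1 / (1 - ε + ε * h x) ≤ 1 / (1 - ε) := by
        apply one_div_le_one_div_of_le (by linarith)
        have := mul_nonneg hε.le (h0 x); linarith
      have h3 : ε * (h x / (1 - ε + ε * h x))
          = (1 - (1 - ε + ε * h x)⁻¹) + ε * (1 / (1 - ε + ε * h x)) := by
        have := (hden x).ne'
        field_simp
        ring
      have h4 := mul_le_mul_of_nonneg_left h2 hε.le
      rw [mul_one_div ε (1 - ε)] at h4
      linarith
    have h5 : ∫ x, ε * (h x / (1 - ε + ε * h x)) ∂μ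
        ≤ ∫ x, (Real.log (1 - ε + ε * h x) + ε / (1 - ε)) ∂μ :=
      integral_mono (hfi.const_mul _) ((hint ε hε hε1).add (integrable_const _)) hpt
    rw [integral_const_mul, integral_add (hint ε hε hε1) (integrable_const _)] at h5
    simp only [integral_const, probReal_univ, one_smul] at h5
    have h6 : ε * ∫ x, h x / (1 - ε + ε * h x) ∂μ ≤ ε * (1 / (1 - ε)) := by
      rw [mul_one_div]; linarith [hlog ε hε hε1]
    exact le_of_mul_le_mul_left h6 hε
  set e : ℕ → ℝ := fun n => 1 / ((n : ℝ) + 2) with he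
  have he0 : ∀ n, 0 < e n := fun n => by simp only [he]; positivity
  have he1 : ∀ n, e n < 1 := fun n => by
    simp only [he]
    rw [div_lt_one (by positivity)]
    have : (0 : ℝ) ≤ n := n.cast_nonneg
    linarith
  have helim : Tendsto e atTop (𝓝 0) := by
    have := tendsto_one_div_add_atTop_nhds_zero_nat (𝕜 := ℝ)
    refine squeeze_zero (fun n => (he0 n).le) (fun n => ?_) this
    exact one_div_le_one_div_of_le (by positivity) (by linarith)
  have hlim : ∀ x, Tendsto (fun n => ENNReal.ofReal (h x / (1 - e n + e n * h x))) atTop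
      (𝓝 (ENNReal.ofReal (h x))) := by
    intro x
    refine ENNReal.tendsto_ofReal ?_
    have h1 : Tendsto (fun n => 1 - e n + e n * h x) atTop (𝓝 (1 - 0 + 0 * h x)) :=
      (tendsto_const_nhds.sub helim).add (helim.mul_const _)
    have h2 : Tendsto (fun n => h x / (1 - e n + e n * h x)) atTop
        (𝓝 (h x / (1 - 0 + 0 * h x))) := tendsto_const_nhds.div h1 (by simp)
    simpa using h2
  have hlimbound : Tendsto (fun n => ENNReal.ofReal (1 / (1 - e n))) atTop (𝓝 1) := by
    have h1 : Tendsto (fun n => 1 / (1 - e n)) atTop (𝓝 (1 / (1 - 0))) :=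
      tendsto_const_nhds.div (tendsto_const_nhds.sub helim) (by simp)
    simpa using ENNReal.tendsto_ofReal h1
  calc ∫⁻ x, ENNReal.ofReal (h x) ∂μ
      = ∫⁻ x, liminf (fun n => ENNReal.ofReal (h x / (1 - e n + e n * h x))) atTop ∂μ :=
        lintegral_congr fun x => (hlim x).liminf_eq.symm
    _ ≤ liminf (fun n => ∫⁻ x, ENNReal.ofReal (h x / (1 - e n + e n * h x)) ∂μ) atTop :=
        lintegral_liminf_le fun n => by fun_prop
    _ ≤ liminf (fun n => ENNReal.ofReal (1 / (1 - e n))) atTop :=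
        liminf_le_liminf (Eventually.of_forall fun n => hbound _ (he0 n) (he1 n))
    _ = 1 := hlimbound.liminf_eq

variable {d : ℕ} {S : Finset (Fin d → ℤ)}

theorem mseDistortion_comm (x y : S → ℝ) : mseDistortion x y = mseDistortion y x := by
  unfold mseDistortion
  congr 1
  exact Finset.sum_congr rfl fun s _ => by ring

theorem mseDistortion_le_two_mul_add (x y z : S → ℝ) :
    mseDistortion x z ≤ 2 * mseDistortion x y + 2 * mseDistortion y z := by
  unfold mseDistortion
  have h : ∑ s : S, (x s - z s) ^ 2
      ≤ 2 * ∑ s : S, (x s - y s) ^ 2 + 2 * ∑ s : S, (y s - z s) ^ 2 := by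
    rw [Finset.mul_sum, Finset.mul_sum, ← Finset.sum_add_distrib]
    exact Finset.sum_le_sum fun s _ => by nlinarith [sq_nonneg (x s - y s - (y s - z s))]
  have hS : (0 : ℝ) ≤ 1 / (S.card : ℝ) := by positivity
  nlinarith [mul_le_mul_of_nonneg_left h hS]

/-- Second moments of the source and a finite mean distortion bound the second moments of the
output, hence the distortion between independent copies of input and output. -/
theorem integrable_mseDistortion_prod {μ : Measure (S → ℝ)} [IsProbabilityMeasure μ]
    (hμ : Integrable (fun x => mseDistortion x 0) μ)
    {ρ : Measure ((S → ℝ) × (S → ℝ))} [IsProbabilityMeasure ρ] (hρ : ρ.fst = μ)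
    (hint : Integrable (fun p => mseDistortion p.1 p.2) ρ) :
    Integrable (fun p => mseDistortion p.1 p.2) (μ.prod ρ.snd) := by
  have hm0 : Measurable fun y : S → ℝ => mseDistortion 0 y := by
    unfold mseDistortion
    fun_prop
  have hx : Integrable (fun p : (S → ℝ) × (S → ℝ) => mseDistortion p.1 0) ρ := by
    rw [← hρ] at hμ
    exact hμ.comp_measurable measurable_fst
  have hxy : Integrable (fun p : (S → ℝ) × (S → ℝ) =>
      2 * mseDistortion p.1 0 + 2 * mseDistortion p.1 p.2) ρ :=
    (hx.const_mul 2).add (hint.const_mul 2)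
  have hyρ : Integrable (fun p : (S → ℝ) × (S → ℝ) => mseDistortion 0 p.2) ρ := by
    refine hxy.mono' (hm0.comp measurable_snd).aestronglyMeasurable (ae_of_all _ fun p => ?_)
    rw [Real.norm_of_nonneg (mseDistortion_nonneg _ _), mseDistortion_comm p.1 0]
    exact mseDistortion_le_two_mul_add 0 p.1 p.2
  have hy : Integrable (fun y => mseDistortion 0 y) ρ.snd :=
    (integrable_map_measure hm0.aestronglyMeasurable measurable_snd.aemeasurable).2 hyρ
  have hsum : Integrable (fun p : (S → ℝ) × (S → ℝ) =>
      2 * mseDistortion p.1 0 + 2 * mseDistortion 0 p.2) (μ.prod ρ.snd) :=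
    ((hμ.comp_fst ρ.snd).const_mul 2).add ((hy.comp_snd μ).const_mul 2)
  refine hsum.mono' measurable_mseDistortion.aestronglyMeasurable (ae_of_all _ fun p => ?_)
  rw [Real.norm_of_nonneg (mseDistortion_nonneg _ _)]
  exact mseDistortion_le_two_mul_add p.1 0 p.2

/-- The optimality condition for the output law of an achieving kernel: tilting at rate `rdSlope`
towards any fixed reproduction `y` has total mass at most one.  It expresses that
`q ↦ ∫ log Z_q dμ` is maximal at the optimal output law, differentiated in the direction of the
point mass at `y`. -/
theorem lintegral_exp_div_partitionFn_le_one {μ : Measure (S → ℝ)} [IsProbabilityMeasure μ]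
    (hμ : Integrable (fun x => mseDistortion x 0) μ) {D : ℝ}
    (hfin : rateDistortion μ D ≠ ∞)
    (hdiff : DifferentiableAt ℝ (fun t => (rateDistortion μ t).toReal) D)
    {κ : Kernel (S → ℝ) (S → ℝ)} (hκ : IsAchievingKernel μ D κ) (y : S → ℝ) :
    ∫⁻ x, ENNReal.ofReal (Real.exp (-(rdSlope μ D * mseDistortion x y))
      / partitionFn (fun p => rdSlope μ D * mseDistortion p.1 p.2) (κ ∘ₘ μ) x) ∂μ ≤ 1 := by
  have := hκ.isMarkov
  set l := rdSlope μ D with hl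
  have hl0 : 0 ≤ l := rdSlope_nonneg hfin hdiff
  -- At slope zero both the numerator and the partition function equal one.
  rcases hl0.eq_or_lt with hlz | hlpos
  · rw [← hlz]
    simp [partitionFn]
  set c : (S → ℝ) × (S → ℝ) → ℝ := fun p => l * mseDistortion p.1 p.2 with hcdef
  have hc : Measurable c := measurable_mseDistortion.const_mul l
  have hc0 : ∀ p, 0 ≤ c p := fun p => mul_nonneg hl0 (mseDistortion_nonneg _ _)
  set qs : Measure (S → ℝ) := κ ∘ₘ μ with hqs
  have hZpos := partitionFn_pos hc hc0 qs
  have hsnd : (μ ⊗ₘ κ).snd = qs := Measure.snd_compProd μ κ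
  have hfst : (μ ⊗ₘ κ).fst = μ := Measure.fst_compProd μ κ
  have hlogs : Integrable (fun x => Real.log (partitionFn c qs x)) μ := by
    refine integrable_log_partitionFn hc hc0 μ qs ?_
    rw [← hsnd]
    exact (integrable_mseDistortion_prod hμ hfst hκ.meets.1).const_mul l
  -- The Lagrangian of the optimal kernel is at least the free energy of its output law.
  have hopt : -∫ x, Real.log (partitionFn c qs x) ∂μ
      ≤ (rateDistortion μ D).toReal + l * D := by
    have hkl : klDiv (μ ⊗ₘ κ) (μ.prod qs) = rateDistortion μ D := hκ.mutualInfo_eq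
    have h := neg_integral_log_partitionFn_le hc hc0 μ qs hlogs (μ ⊗ₘ κ) hfst
      (hκ.meets.1.const_mul l) (hkl ▸ hfin)
    rw [hkl, integral_const_mul] at h
    have := mul_le_mul_of_nonneg_left hκ.meets.2 hl0
    linarith
  have hmix : ∀ ε : ℝ, 0 < ε → ε < 1 →
      Integrable (fun x => Real.log (1 - ε + ε * (Real.exp (-c (x, y)) / partitionFn c qs x))) μ ∧
      ∫ x, Real.log (1 - ε + ε * (Real.exp (-c (x, y)) / partitionFn c qs x)) ∂μ ≤ 0 := by
    intro ε hε hε1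
    lift ε to NNReal using hε.le
    obtain ⟨θ, hθ⟩ : ∃ θ : NNReal, (θ : ℝ) = 1 - ε := ⟨⟨1 - ε, by linarith⟩, rfl⟩
    have hθ0 : (0 : ℝ) < θ := by rw [hθ]; linarith
    have hsum : θ + ε = 1 := by
      rw [← NNReal.coe_inj]; push_cast; rw [hθ]; ring
    set q : Measure (S → ℝ) := θ • qs + ε • Measure.dirac y with hq
    have hqp : IsProbabilityMeasure q := ⟨by
      simp only [hq, Measure.add_apply, Measure.smul_apply, measure_univ]
      simp only [ENNReal.smul_def, smul_eq_mul, mul_one]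
      exact_mod_cast hsum⟩
    have hZ : ∀ x, partitionFn c q x = θ * partitionFn c qs x + ε * Real.exp (-c (x, y)) :=
      fun x => partitionFn_mix_dirac hc hc0 qs θ ε y x
    have hlogq : Integrable (fun x => Real.log (partitionFn c q x)) μ := by
      refine (hlogs.abs.add (integrable_const |Real.log θ|)).mono'
        (measurable_partitionFn hc q).log.aestronglyMeasurable (ae_of_all _ fun x => ?_)
      have hle : θ * partitionFn c qs x ≤ partitionFn c q x := by
        rw [hZ]; linarith [mul_pos hε (Real.exp_pos (-c (x, y)))]
      have h1 := Real.log_le_log (mul_pos hθ0 (hZpos x)) hle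
      rw [Real.log_mul hθ0.ne' (hZpos x).ne'] at h1
      rw [Real.norm_eq_abs, abs_of_nonpos (Real.log_nonpos (partitionFn_pos hc hc0 q x).le
        (partitionFn_le_one hc hc0 q x)), Pi.add_apply]
      linarith [neg_abs_le (Real.log θ), neg_abs_le (Real.log (partitionFn c qs x))]
    have heq : (fun x => Real.log (1 - ε + ε * (Real.exp (-c (x, y)) / partitionFn c qs x)))
        = fun x => Real.log (partitionFn c q x) - Real.log (partitionFn c qs x) := by
      ext x
      have h1 := hZpos x
      rw [← Real.log_div (partitionFn_pos hc hc0 q x).ne' h1.ne', hZ, hθ]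
      congr 1
      field_simp
    rw [heq]
    refine ⟨hlogq.sub hlogs, ?_⟩
    rw [integral_sub hlogq hlogs]
    have hρp := isProbabilityMeasure_gibbsCoupling hc hc0 μ q
    obtain ⟨hne, hval⟩ := klDiv_gibbsCoupling hc hc0 μ q hlogq
    have hci : Integrable (fun p => mseDistortion p.1 p.2) (gibbsCoupling c μ q) := by
      have h := (integrable_cost_gibbsCoupling hc hc0 μ q hlogq).const_mul l⁻¹
      simpa [hcdef, inv_mul_cancel_left₀ hlpos.ne'] using h
    have hsup := rateDistortion_add_slope_le hfin hdiff hκ (fst_gibbsCoupling hc hc0 μ q) q hci hne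
    rw [← integral_const_mul] at hsup
    linarith
  refine lintegral_le_one_of_integral_log_mix_nonpos μ ?_ (fun x => ?_)
    (fun ε h0 h1 => (hmix ε h0 h1).1) (fun ε h0 h1 => (hmix ε h0 h1).2)
  · exact ((hc.comp (measurable_id.prodMk measurable_const)).neg.exp).div
      (measurable_partitionFn hc qs)
  · exact div_nonneg (Real.exp_pos _).le (hZpos x).le

end Optimality

/-! ### The converse bound -/

section Converse

variable {d : ℕ} {S : Finset (Fin d → ℤ)}

theorem integrable_mseDistortion_zero_of_isGaussian (μ : Measure (S → ℝ)) [IsGaussian μ] :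
    Integrable (fun x => mseDistortion x 0) μ := by
  unfold mseDistortion
  refine (integrable_finsetSum _ fun s _ => ?_).const_mul _
  have h := (IsGaussian.memLp_dual μ (ContinuousLinearMap.proj (R := ℝ) s) 2
    (by simp)).integrable_sq
  simpa using h

/-- Where the tilted information is at least `log N + γ`, any reproduction `y` within distortion
`D` of `x` has Gibbs density at least `N exp γ`. -/
theorem mul_exp_le_of_le_tiltedInfo {μ : Measure (S → ℝ)} {κ : Kernel (S → ℝ) (S → ℝ)} {D : ℝ}
    (hl : 0 ≤ rdSlope μ D) {N : ℕ} (hN : N ≠ 0) {γ : ℝ} {x y : S → ℝ}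
    (hZ : 0 < partitionFn (fun p => rdSlope μ D * mseDistortion p.1 p.2) (κ ∘ₘ μ) x)
    (hx : Real.log N + γ ≤ tiltedInfo μ κ D x) (hy : mseDistortion x y ≤ D) :
    N * Real.exp γ ≤ Real.exp (-(rdSlope μ D * mseDistortion x y))
      / partitionFn (fun p => rdSlope μ D * mseDistortion p.1 p.2) (κ ∘ₘ μ) x := by
  set l := rdSlope μ D with hldef
  set Z := partitionFn (fun p => l * mseDistortion p.1 p.2) (κ ∘ₘ μ) x with hZdef
  have htilt : tiltedInfo μ κ D x = -(l * D) - Real.log Z := by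
    have : ∫ y, Real.exp (l * (D - mseDistortion x y)) ∂(κ ∘ₘ μ) = Real.exp (l * D) * Z := by
      rw [hZdef, partitionFn, ← integral_const_mul]
      congr 1 with y
      rw [← Real.exp_add]
      ring_nf
    rw [tiltedInfo, ← hldef, this, Real.log_mul (Real.exp_ne_zero _) hZ.ne', Real.log_exp]
    ring
  have hNpos : (0 : ℝ) < N := by exact_mod_cast Nat.pos_of_ne_zero hN
  calc N * Real.exp γ = Real.exp (Real.log N + γ) := by rw [Real.exp_add, Real.exp_log hNpos]
    _ ≤ Real.exp (-(l * mseDistortion x y) - Real.log Z) := by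
        refine Real.exp_le_exp.2 ?_
        have := mul_le_mul_of_nonneg_left hy hl
        linarith
    _ = Real.exp (-(l * mseDistortion x y)) / Z := by rw [Real.exp_sub, Real.exp_log hZ]

/-- For a single reproduction `y`, Markov's inequality and the optimality condition bound the
probability that the source has large tilted information and yet lies within distortion `D`
of `y`. -/
theorem measureReal_tiltedInfo_ge_and_mseDistortion_le {Ω : Type*} [MeasurableSpace Ω]
    (P : Measure Ω) [IsProbabilityMeasure P] {X : Ω → S → ℝ} (hXm : Measurable X)
    (hμ : Integrable (fun x => mseDistortion x 0) (P.map X)) {D : ℝ}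
    (hfin : rateDistortion (P.map X) D ≠ ∞)
    (hdiff : DifferentiableAt ℝ (fun t => (rateDistortion (P.map X) t).toReal) D)
    {κ : Kernel (S → ℝ) (S → ℝ)} (hκ : IsAchievingKernel (P.map X) D κ)
    {N : ℕ} (hN : N ≠ 0) (γ : ℝ) (y : S → ℝ) :
    P.real {ω | Real.log N + γ ≤ tiltedInfo (P.map X) κ D (X ω) ∧ mseDistortion (X ω) y ≤ D}
      ≤ (N * Real.exp γ)⁻¹ := by
  have := hκ.isMarkov
  have : IsProbabilityMeasure (P.map X) := Measure.isProbabilityMeasure_map hXm.aemeasurable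
  set l := rdSlope (P.map X) D with hl
  have hl0 : 0 ≤ l := rdSlope_nonneg hfin hdiff
  set c : (S → ℝ) × (S → ℝ) → ℝ := fun p => l * mseDistortion p.1 p.2 with hcdef
  have hc : Measurable c := measurable_mseDistortion.const_mul l
  have hc0 : ∀ p, 0 ≤ c p := fun p => mul_nonneg hl0 (mseDistortion_nonneg _ _)
  have hZpos := partitionFn_pos hc hc0 (κ ∘ₘ P.map X)
  set h : (S → ℝ) → ℝ := fun x => Real.exp (-(l * mseDistortion x y))
    / partitionFn c (κ ∘ₘ P.map X) x with hh
  have hhm : Measurable h := ((hc.comp (measurable_id.prodMk measurable_const)).neg.exp).div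
    (measurable_partitionFn hc _)
  have hmean : ∫⁻ ω, ENNReal.ofReal (h (X ω)) ∂P ≤ 1 := by
    rw [← lintegral_map (f := fun x => ENNReal.ofReal (h x)) hhm.ennreal_ofReal hXm]
    exact lintegral_exp_div_partitionFn_le_one hμ hfin hdiff hκ y
  have hNpos : (0 : ℝ) < N := by exact_mod_cast Nat.pos_of_ne_zero hN
  have hT : 0 < N * Real.exp γ := mul_pos hNpos (Real.exp_pos _)
  refine ENNReal.toReal_le_of_le_ofReal (inv_nonneg.2 hT.le) ?_
  calc P {ω | Real.log N + γ ≤ tiltedInfo (P.map X) κ D (X ω) ∧ mseDistortion (X ω) y ≤ D}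
      ≤ P {ω | ENNReal.ofReal (N * Real.exp γ) ≤ ENNReal.ofReal (h (X ω))} := by
        refine measure_mono fun ω hω => ?_
        exact ENNReal.ofReal_le_ofReal (mul_exp_le_of_le_tiltedInfo hl0 hN (hZpos _) hω.1 hω.2)
    _ ≤ (∫⁻ ω, ENNReal.ofReal (h (X ω)) ∂P) / ENNReal.ofReal (N * Real.exp γ) :=
        meas_ge_le_lintegral_div (hhm.comp hXm).ennreal_ofReal.aemeasurable
          (ENNReal.ofReal_pos.2 hT).ne' ENNReal.ofReal_ne_top
    _ ≤ 1 / ENNReal.ofReal (N * Real.exp γ) := by gcongr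
    _ = ENNReal.ofReal (N * Real.exp γ)⁻¹ := by
        rw [one_div, ENNReal.ofReal_inv_of_pos hT]

/-- The codeword of a regionwise code selected by one regional index for each region. -/
def RegionwiseCode.codeword {ι : Type*} {label : S → ι} {M : ι → ℕ}
    (c : RegionwiseCode label M) (k : ∀ r, Fin (M r)) : S → ℝ :=
  fun s => c.decode (label s) (k (label s)) ⟨s, rfl⟩

end Converse

theorem mainTheorem3
    {Ω : Type*} [MeasurableSpace Ω] (P : Measure Ω) [IsProbabilityMeasure P]
    {d : ℕ} (S : Finset (Fin d → ℤ)) {ι : Type*} [Fintype ι] (label : S → ι)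
    (m : ι → ℝ) (Γ : ι → (Fin d → ℤ) → ℝ)
    (X : Ω → S → ℝ) (hX : IsPiecewiseHomogeneousGaussian P label m Γ X)
    (D : ℝ) (hD : 0 ≤ D)
    (hfin : rateDistortion (P.map X) D ≠ ∞)
    (hdiff : DifferentiableAt ℝ (fun t => (rateDistortion (P.map X) t).toReal) D)
    (κ : Kernel (S → ℝ) (S → ℝ)) (hκ : IsAchievingKernel (P.map X) D κ)
    (M : ι → ℕ) (c : RegionwiseCode label M)
    (γ : ℝ) (hγ : 0 < γ) :
    c.excessProb P X D ≥
      P.real {ω | tiltedInfo (P.map X) κ D (X ω) ≥ Real.log ((∏ r, M r : ℕ) : ℝ) + γ}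
        - Real.exp (-γ) := by
  classical
  have hgauss : IsGaussian (P.map X) := hX.gaussian.isGaussian_map
  have hμ := integrable_mseDistortion_zero_of_isGaussian (P.map X)
  -- An encoder has a nonempty domain, so every region has at least one codeword.
  have hN : (∏ r, M r) ≠ 0 := Finset.prod_ne_zero_iff.2 fun r _ hr =>
    (hr ▸ c.encode r fun _ => 0 : Fin 0).elim0
  set N := ∏ r, M r with hNdef
  have hNpos : (0 : ℝ) < N := by exact_mod_cast Nat.pos_of_ne_zero hN
  set A : (∀ r, Fin (M r)) → Set Ω := fun k =>
    {ω | Real.log N + γ ≤ tiltedInfo (P.map X) κ D (X ω) ∧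
      mseDistortion (X ω) (c.codeword k) ≤ D} with hA
  -- No measurability of the encoders is available; subadditivity holds for the outer measure.
  have hsub : {ω | tiltedInfo (P.map X) κ D (X ω) ≥ Real.log (N : ℝ) + γ}
      ⊆ {ω | D < mseDistortion (X ω) (c.reconstruct (X ω))} ∪ ⋃ k, A k := by
    intro ω hω
    rcases lt_or_ge D (mseDistortion (X ω) (c.reconstruct (X ω))) with h | h
    · exact Or.inl h
    · exact Or.inr (Set.mem_iUnion.2
        ⟨fun r => c.encode r (restrictRegion label r (X ω)), hω, h⟩)
  have hunion : P.real (⋃ k, A k) ≤ Real.exp (-γ) := by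
    calc P.real (⋃ k, A k) ≤ ∑ k, P.real (A k) := measureReal_iUnion_fintype_le _
      _ ≤ ∑ _k : ∀ r, Fin (M r), (N * Real.exp γ)⁻¹ := Finset.sum_le_sum fun k _ =>
          measureReal_tiltedInfo_ge_and_mseDistortion_le P hX.measurable hμ hfin hdiff hκ hN γ _
      _ = Real.exp (-γ) := by
          rw [Finset.sum_const, Finset.card_univ, Fintype.card_pi]
          simp only [Fintype.card_fin, nsmul_eq_mul]
          rw [← hNdef, mul_inv, mul_inv_cancel_left₀ hNpos.ne', Real.exp_neg]
  have h := (measureReal_mono hsub (measure_ne_top P _)).trans (measureReal_union_le _ _)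
  unfold RegionwiseCode.excessProb
  linarith
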